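/- Corollary 5.7. Let $S\subset(\mathbb N_0,+)$ be a numerical monoid (a submonoid with finite complement in $\mathbb N_0$) whose set of atoms (irreducible elements) is $\mathcal A(S)=\{n_1,n_2,n_3\}$, where $n_1,n_2,n_3$ are three distinct integers with $\gcd(n_1,n_2)=\gcd(n_1,n_3)=\gcd(n_2,n_3)=1$. Let $\mathsf Z(S)$ be the free commutative monoid with basis $\mathcal A(S)$, with length $|z|=\sum_u k_u$ for $z=\sum_u k_u\boldsymbol u$, factorization homomorphism $\pi:\mathsf Z(S)\to S$, $\pi(z)=\sum_u k_u u$, and $\mathsf Z(a)=\pi^{-1}(a)$ for $a\in S$. Write $x\mid y$ for divisibility (in $S$: $y-x\in S$; in $\mathsf Z(S)$: coordinatewise $\le$), and for $z,z'\in\mathsf Z(S)$ with coordinatewise minimum $g$ put $\mathsf d(z,z')=\max\{|z-g|,|z'-g|\}$. Definitions. A subset $\sigma\subset\mathsf Z(S)\times\mathsf Z(S)$ is a presentation of $S$ if the congruence on $\mathsf Z(S)$ generated by $\sigma$ is $\{(x,y):\pi(x)=\pi(y)\}$; it is generic if no proper subset of $\sigma$ is a presentation and, for every $(x,y)\in\sigma$,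 each atom occurs in $x+y$. All of the following invariants lie in $\mathbb N_0\cup\{\infty\}$. - The catenary degree $\mathsf c(S)$ is the supremum over $a\in S$ of the smallest $N$ such that any two $z,z'\in\mathsf Z(a)$ are joined by a finite sequence $z=z_0,\dots,z_k=z'$ in $\mathsf Z(a)$ with $\mathsf d(z_{i-1},z_i)\le N$ for all $i$. - $\omega(S)$ is the supremum over atoms $u$ of the smallest $N$ such that whenever $m\ge1$, $a_1,\dots,a_m\in S$ and $u\mid a_1+\dots+a_m$, there is $\Omega\subset\{1,\dots,m\}$ with $|\Omega|\le N$ and $u\mid\sum_{\nu\in\Omega}a_\nu$. - The tame degree $\mathsf t(S)$ is the supremum over $a\in S$ and atoms $u$ of the smallest $N$ such that, if some factorization of $a$ is divisible by $\boldsymbol u$, then for every $z\in\mathsf Z(a)$ there is $z'\in\mathsf Z(a)$ with $\boldsymbol u\mid z'$ and $\mathsf d(z,z')\le N$. Then $S$ has a generic presentation and $$\mathsf c(S)=\omega(S)=\mathsf t(S).$$ More precisely, for $\{i,j,k\}=\{1,2,3\}$ let $c_i$ be the smallest positive integer $m$ such that $mn_i\in\langle n_j,n_k\rangle$ (the submonoid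 of $\mathbb N_0$ generated by $n_j,n_k$), and let $r_{i,j},r_{i,k}\in\mathbb N_0$ be any integers with $c_in_i=r_{i,j}n_j+r_{i,k}n_k$. Then $$\mathsf c(S)=\max\{c_1,c_2,c_3,\ r_{1,2}+r_{1,3},\ r_{2,1}+r_{2,3},\ r_{3,1}+r_{3,2}\}.$$ -/

import Mathlib

namespace Factorization

/-- A numerical monoid: a submonoid of `(ℕ, +)` with finite complement. -/
def IsNumericalMonoid (S : AddSubmonoid ℕ) : Prop :=
  ((S : Set ℕ)ᶜ).Finite

/-! The monoid `M` below is written additively. It is understood to be reduced (zero is the only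
unit), as every submonoid of `ℕ` is, so that `M` is its own associated reduced monoid. -/

/-- The set of atoms (irreducible elements) of `M`. -/
def atoms (M : Type*) [AddCommMonoid M] : Set M := {u | AddIrreducible u}

/-- The factorization monoid of `M`: the free commutative monoid with basis the set of atoms. -/
abbrev Fact (M : Type*) [AddCommMonoid M] : Type _ := atoms M →₀ ℕ

section

variable {M : Type*} [AddCommMonoid M]

/-- The factorization homomorphism, `∑ kᵤ 𝐮 ↦ ∑ kᵤ u`. -/
noncomputable def eval (z : Fact M) : M := z.sum fun u k => k • (u : M)

/-- The length of a factorization. -/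
noncomputable def length (z : Fact M) : ℕ := z.degree

/-- The set of factorizations of `a`. -/
def factorizations (a : M) : Set (Fact M) := {z | eval z = a}

/-- The distance of two factorizations: remove the greatest common divisor (the pointwise minimum)
from both and take the larger of the two lengths that remain. -/
noncomputable def dist (z w : Fact M) : ℕ :=
  max (length (z - z ⊓ w)) (length (w - z ⊓ w))

/-- `σ` is a presentation of `M`: the congruence on the factorization monoid generated by `σ` is the
monoid of relations `{(x, y) | eval x = eval y}`. -/
def IsPresentation (σ : Set (Fact M × Fact M)) : Prop :=
  ∀ x y : Fact M, addConGen (fun x y => (x, y) ∈ σ) x y ↔ eval x = eval y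

/-- No proper subset of the presentation `σ` is a presentation. -/
def IsMinimalPresentation (σ : Set (Fact M × Fact M)) : Prop :=
  IsPresentation σ ∧ ∀ τ : Set (Fact M × Fact M), τ ⊂ σ → ¬ IsPresentation τ

/-- A minimal presentation in which every atom occurs in every relation. -/
def IsGenericPresentation (σ : Set (Fact M × Fact M)) : Prop :=
  IsMinimalPresentation σ ∧
    ∀ x y : Fact M, (x, y) ∈ σ → ∀ u : atoms M, u ∈ (x + y).support

/-- `b` divides `a` in `M` (additively written). -/
def Divides (b a : M) : Prop := ∃ c : M, a = b + c

/-- `z` and `w` can be concatenated by an `N`-chain of factorizations of `a`. -/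
def Concatenated (a : M) (N : ℕ∞) (z w : Fact M) : Prop :=
  Relation.ReflTransGen
    (fun x y => x ∈ factorizations a ∧ y ∈ factorizations a ∧ (dist x y : ℕ∞) ≤ N) z w

/-- The catenary degree of the element `a`. -/
noncomputable def catenaryDegreeAt (a : M) : ℕ∞ :=
  sInf {N : ℕ∞ | ∀ z ∈ factorizations a, ∀ w ∈ factorizations a, Concatenated a N z w}

/-- The invariant `ω(M, b)`. -/
noncomputable def omegaAt (b : M) : ℕ∞ :=
  sInf {N : ℕ∞ | ∀ (n : ℕ) (a : Fin n → M), 0 < n → Divides b (∑ i, a i) →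
    ∃ Ω : Finset (Fin n), (Ω.card : ℕ∞) ≤ N ∧ Divides b (∑ i ∈ Ω, a i)}

/-- The invariant `t(a, x)`, for an element `a` and a factorization `x`. -/
noncomputable def tameDegreeAt (a : M) (x : Fact M) : ℕ∞ :=
  sInf {N : ℕ∞ | (∃ w ∈ factorizations a, x ≤ w) → ∀ z ∈ factorizations a,
    ∃ w ∈ factorizations a, x ≤ w ∧ (dist z w : ℕ∞) ≤ N}

end

/-- The catenary degree of `M`. -/
noncomputable def catenaryDegree (M : Type*) [AddCommMonoid M] : ℕ∞ :=
  ⨆ a : M, catenaryDegreeAt a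

/-- The invariant `ω(M)`. -/
noncomputable def omega (M : Type*) [AddCommMonoid M] : ℕ∞ :=
  ⨆ u : atoms M, omegaAt (u : M)

/-- The tame degree of `M`. -/
noncomputable def tameDegree (M : Type*) [AddCommMonoid M] : ℕ∞ :=
  ⨆ u : atoms M, ⨆ a : M, tameDegreeAt a (Finsupp.single u 1)

end Factorization

/-! The relations `c i * n i = r i j * n j + r i k * n k` control everything. Coprimality and
minimality make all their coefficients positive, and the element `c i * n i` then has exactly two
factorizations, with no common atom (`IsRelationSystem.eq_or_eq`). Such an isolated pair bounds all
three invariants below by the lengths of both sides, since nothing shorter links one factorization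
to the other.

Conversely, if an atom is missing from `z` but occurs in another factorization of the same element,
one of the three relations applies to `z` and brings it in (`IsRelationSystem.exchange`). This
exchange property shows that the relations form a presentation and bounds each invariant above by
the largest length in a relation. Isolation makes the presentation minimal, and positivity makes it
generic. -/

namespace Factorization

/-! ### Factorizations, distances, and lower bounds from isolated pairs -/

section General

variable {M : Type*} [AddCommMonoid M]

@[simp] lemma eval_zero : eval (0 : Fact M) = 0 := by simp [eval]

lemma eval_add (z w : Fact M) : eval (z + w) = eval z + eval w :=
  Finsupp.sum_add_index' (fun _ => zero_nsmul _) (fun _ _ _ => add_nsmul _ _ _)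

@[simp] lemma eval_single (u : atoms M) (k : ℕ) : eval (Finsupp.single u k) = k • (u : M) := by
  simp [eval]

lemma eval_sum {ι : Type*} (s : Finset ι) (z : ι → Fact M) :
    eval (∑ i ∈ s, z i) = ∑ i ∈ s, eval (z i) := by
  classical
  induction s using Finset.induction_on with
  | empty => simp
  | insert a s ha ih => rw [Finset.sum_insert ha, Finset.sum_insert ha, eval_add, ih]

@[simp] lemma length_zero : length (0 : Fact M) = 0 := by simp [length]

lemma length_add (z w : Fact M) : length (z + w) = length z + length w := by
  simp [length]

@[simp] lemma length_single (u : atoms M) (k : ℕ) : length (Finsupp.single u k) = k := by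
  simp [length]

lemma length_eq_zero {z : Fact M} : length z = 0 ↔ z = 0 := Finsupp.degree_eq_zero_iff z

lemma length_mono {z w : Fact M} (h : z ≤ w) : length z ≤ length w := by
  obtain ⟨g, rfl⟩ := exists_add_of_le h
  rw [length_add]; exact Nat.le_add_right _ _

lemma single_le {u : atoms M} {z : Fact M} (h : 0 < z u) : Finsupp.single u 1 ≤ z := by
  intro v
  by_cases hv : u = v
  · subst hv; simpa using Nat.succ_le_of_lt h
  · simp [Finsupp.single_eq_of_ne' hv]

lemma pos_of_single_le {u : atoms M} {z : Fact M} (h : Finsupp.single u 1 ≤ z) : 0 < z u := by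
  have := h u
  rw [Finsupp.single_eq_same] at this
  exact this

lemma exists_pos {z : Fact M} (h : z ≠ 0) : ∃ u, 0 < z u := by
  obtain ⟨u, hu⟩ := Finsupp.ne_iff.1 h
  exact ⟨u, Nat.pos_of_ne_zero hu⟩

lemma dist_add_right (x y g : Fact M) : dist (x + g) (y + g) = dist x y := by
  have h1 : (x + g) - (x + g) ⊓ (y + g) = x - x ⊓ y := by
    ext u; simp only [Finsupp.tsub_apply, Finsupp.add_apply, Finsupp.inf_apply]; omega
  have h2 : (y + g) - (x + g) ⊓ (y + g) = y - x ⊓ y := by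
    ext u; simp only [Finsupp.tsub_apply, Finsupp.add_apply, Finsupp.inf_apply]; omega
  rw [dist, dist, h1, h2]

lemma dist_le (x y : Fact M) : dist x y ≤ max (length x) (length y) :=
  max_le_max (length_mono tsub_le_self) (length_mono tsub_le_self)

lemma dist_self (x : Fact M) : dist x x = 0 := by simp [dist]

lemma dist_of_inf_eq_zero {x y : Fact M} (h : x ⊓ y = 0) :
    dist x y = max (length x) (length y) := by
  simp [dist, h]

/-- If an atom occurs in some factorization with the same value as `z`, then either it occurs in
`z`, or one application of a relation in `σ` (in either direction) to `z` makes it occur. -/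
def Exchanges (σ : Set (Fact M × Fact M)) : Prop :=
  ∀ (u : atoms M) (z w : Fact M), eval w = eval z → 0 < w u → z u = 0 →
    ∃ x y g, z = x + g ∧ ((x, y) ∈ σ ∨ (y, x) ∈ σ) ∧ 0 < y u

/-- `x` and `y` are coprime and they are the only factorizations of their common value. -/
structure IsIsolatedPair (x y : Fact M) : Prop where
  eval_eq : eval x = eval y
  inf_eq : x ⊓ y = 0
  left_ne : x ≠ 0
  right_ne : y ≠ 0
  eq_or : ∀ z, eval z = eval x → z = x ∨ z = y

namespace IsIsolatedPair

variable {x y : Fact M}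

lemma symm (h : IsIsolatedPair x y) : IsIsolatedPair y x where
  eval_eq := h.eval_eq.symm
  inf_eq := by rw [inf_comm]; exact h.inf_eq
  left_ne := h.right_ne
  right_ne := h.left_ne
  eq_or z hz := (h.eq_or z (hz.trans h.eval_eq.symm)).symm

lemma ne (h : IsIsolatedPair x y) : x ≠ y := by
  rintro rfl
  exact h.left_ne (by simpa using h.inf_eq)

lemma apply_eq_zero (h : IsIsolatedPair x y) {u : atoms M} (hu : 0 < y u) : x u = 0 := by
  have := DFunLike.congr_fun h.inf_eq u
  simp only [Finsupp.inf_apply, Finsupp.coe_zero, Pi.zero_apply] at this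
  omega

/-- A chain leaving `x` can only jump straight to `y`, and coprimality leaves nothing to cancel in
that distance. -/
lemma max_length_le_catenaryDegree (h : IsIsolatedPair x y) :
    ((max (length x) (length y) : ℕ) : ℕ∞) ≤ catenaryDegree M := by
  refine le_trans ?_ (le_iSup (catenaryDegreeAt (M := M)) (eval x))
  refine le_sInf fun N hN => ?_
  have hc : Concatenated (eval x) N x y := hN x rfl y h.eval_eq.symm
  by_contra hlt
  have key : ∀ z, Relation.ReflTransGen (fun z w => z ∈ factorizations (eval x) ∧
      w ∈ factorizations (eval x) ∧ (dist z w : ℕ∞) ≤ N) x z → z = x := by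
    intro z hz
    induction hz with
    | refl => rfl
    | tail _ hstep ih =>
      subst ih
      obtain ⟨-, hw, hd⟩ := hstep
      rcases h.eq_or _ hw with rfl | rfl
      · rfl
      · rw [dist_of_inf_eq_zero h.inf_eq] at hd
        exact absurd hd hlt
  exact h.ne (key y hc).symm

lemma max_length_le_tameDegree (h : IsIsolatedPair x y) :
    ((max (length x) (length y) : ℕ) : ℕ∞) ≤ tameDegree M := by
  obtain ⟨u, hu⟩ := exists_pos h.right_ne
  refine le_trans ?_ (le_iSup_of_le u (le_iSup
    (fun a : M => tameDegreeAt a (Finsupp.single u 1)) (eval x)))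
  refine le_sInf fun N hN => ?_
  obtain ⟨w, hw, huw, hd⟩ := hN ⟨y, h.eval_eq.symm, single_le hu⟩ x rfl
  rcases h.eq_or w hw with rfl | rfl
  · have := h.apply_eq_zero hu
    have := pos_of_single_le huw
    omega
  · rwa [dist_of_inf_eq_zero h.inf_eq] at hd

end IsIsolatedPair

lemma exists_sum_fin (x : Fact M) :
    ∃ b : Fin (length x) → atoms M, ∑ i, Finsupp.single (b i) 1 = x := by
  induction hn : length x generalizing x with
  | zero => exact ⟨Fin.elim0, by simp [length_eq_zero.1 hn]⟩
  | succ n ih =>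
    obtain ⟨u, hu⟩ := exists_pos (z := x) (by rintro rfl; simp at hn)
    obtain ⟨g, rfl⟩ := exists_add_of_le (single_le hu)
    rw [length_add, length_single, add_comm] at hn
    obtain ⟨b, hb⟩ := ih g (by omega)
    exact ⟨Fin.cons u b, by simp [Fin.sum_univ_succ, hb]⟩

lemma length_sum_single {ι : Type*} (s : Finset ι) (b : ι → atoms M) :
    length (∑ i ∈ s, Finsupp.single (b i) 1) = s.card := by
  simp [length]

lemma IsIsolatedPair.length_le_omega {x y : Fact M} (h : IsIsolatedPair x y)
    (hM : Function.Surjective (eval (M := M))) : (length x : ℕ∞) ≤ omega M := by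
  classical
  obtain ⟨u, hu⟩ := exists_pos h.right_ne
  refine le_trans ?_ (le_iSup (fun u : atoms M => omegaAt (u : M)) u)
  refine le_sInf fun N hN => ?_
  obtain ⟨b, hb⟩ := exists_sum_fin x
  have hpos : 0 < length x := Nat.pos_of_ne_zero fun h0 => h.left_ne (length_eq_zero.1 h0)
  have heval : ∀ s : Finset (Fin (length x)),
      eval (∑ i ∈ s, Finsupp.single (b i) 1) = ∑ i ∈ s, (b i : M) := by
    intro s
    simp [eval_sum]
  obtain ⟨g, hg⟩ := exists_add_of_le (single_le hu)
  obtain ⟨Ω, hcard, s, hs⟩ := hN (length x) (fun i => (b i : M)) hpos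
    ⟨eval g, by rw [← heval, hb, h.eval_eq, hg, eval_add]; simp⟩
  obtain ⟨t, rfl⟩ := hM s
  refine le_trans ?_ hcard
  have hsplit : (∑ i ∈ Ω, Finsupp.single (b i) 1) + ∑ i ∈ Ωᶜ, Finsupp.single (b i) 1 = x := by
    rw [Finset.sum_add_sum_compl, hb]
  set p := ∑ i ∈ Ωᶜ, Finsupp.single (b i) 1 with hp
  have hz : eval (Finsupp.single u 1 + t + p) = eval x := by
    rw [← hsplit, eval_add, eval_add, eval_add, heval Ω, hs]; simp
  have hx0 := h.apply_eq_zero hu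
  -- The atom `u` does not occur in `x`, so the factorization in `hz` is `y`. The unused part `p` of
  -- `x` then divides both sides and vanishes: no proper subsum is divisible by `u`.
  have hp0 : p = 0 := by
    rcases h.eq_or _ hz with hx | hy
    · have := DFunLike.congr_fun hx u
      simp [hx0] at this
    · have hpx : p ≤ x := by rw [← hsplit]; exact le_add_self
      have hpy : p ≤ y := by rw [← hy]; exact le_add_self
      have := le_inf hpx hpy
      rw [h.inf_eq] at this
      exact le_antisymm this (zero_le)
  rw [hp0, add_zero] at hsplit
  rw [← length_sum_single Ω b, hsplit]

/-! ### Presentations and upper bounds from the exchange property -/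

section Upper

variable {σ : Set (Fact M × Fact M)}

lemma Exchanges.exists_eval_eq (hσ : Exchanges σ) (hev : ∀ x y, (x, y) ∈ σ → eval x = eval y)
    {u : atoms M} {z w : Fact M} (hzw : eval w = eval z) (hu : 0 < w u) (hz : z u = 0) :
    ∃ x y g, z = x + g ∧ ((x, y) ∈ σ ∨ (y, x) ∈ σ) ∧ 0 < y u ∧ eval (y + g) = eval z := by
  obtain ⟨x, y, g, rfl, hxy, hy⟩ := hσ u z w hzw hu hz
  refine ⟨x, y, g, rfl, hxy, hy, ?_⟩
  rw [eval_add, eval_add]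
  rcases hxy with h | h
  · rw [hev _ _ h]
  · rw [hev _ _ h]

/-- An equivalence relation on factorizations that is stable under translation and contains `σ`
relates any two factorizations with the same value. -/
lemma Exchanges.induction [IsCancelAdd M] (hσ : Exchanges σ)
    (hev : ∀ x y, (x, y) ∈ σ → eval x = eval y) (h0 : ∀ z : Fact M, eval z = 0 → z = 0)
    {P : Fact M → Fact M → Prop} (hrefl : ∀ z, P z z)
    (htrans : ∀ {x y z}, eval x = eval y → eval y = eval z → P x y → P y z → P x z)
    (hadd : ∀ {x y} (g), eval x = eval y → P x y → P (x + g) (y + g))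
    (hrel : ∀ x y, (x, y) ∈ σ → P x y ∧ P y x) (z w : Fact M) (hzw : eval z = eval w) :
    P z w := by
  -- Pick an atom of `w`, make it occur in `z` by one exchange, cancel it on both sides, and recurse
  -- on the shorter `w`.
  induction hn : length w generalizing z w with
  | zero =>
    rw [length_eq_zero] at hn
    subst hn
    rw [h0 z (by simpa using hzw)]
    exact hrefl 0
  | succ n ih =>
    obtain ⟨u, hu⟩ := exists_pos (z := w) (by rintro rfl; simp at hn)
    obtain ⟨z', hzz', hP, hz'⟩ : ∃ z', eval z' = eval z ∧ P z z' ∧ 0 < z' u := by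
      rcases Nat.eq_zero_or_pos (z u) with hzu | hzu
      · obtain ⟨x, y, g, rfl, hxy, hy, he⟩ := hσ.exists_eval_eq hev hzw.symm hu hzu
        refine ⟨y + g, he, hadd g ?_ ?_, ?_⟩
        · rcases hxy with h | h
          exacts [hev _ _ h, (hev _ _ h).symm]
        · rcases hxy with h | h
          exacts [(hrel _ _ h).1, (hrel _ _ h).2]
        · rw [Finsupp.add_apply]; omega
      · exact ⟨z, rfl, hrefl z, hzu⟩
    obtain ⟨a, rfl⟩ := exists_add_of_le (single_le hu)
    obtain ⟨b, rfl⟩ := exists_add_of_le (single_le hz')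
    have hab : eval b = eval a := by
      have := hzz'.trans hzw
      rw [eval_add, eval_add] at this
      exact add_left_cancel this
    rw [length_add, length_single] at hn
    refine htrans hzz'.symm (hzz'.trans hzw) hP ?_
    rw [add_comm _ b, add_comm _ a]
    exact hadd _ hab (ih b a hab (by omega))

lemma Exchanges.isPresentation [IsCancelAdd M] (hσ : Exchanges σ)
    (hev : ∀ x y, (x, y) ∈ σ → eval x = eval y) (h0 : ∀ z : Fact M, eval z = 0 → z = 0) :
    IsPresentation σ := by
  intro x y
  constructor
  · intro h
    change AddConGen.Rel _ x y at h
    induction h with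
    | of x y h => exact hev x y h
    | refl => rfl
    | symm _ ih => exact ih.symm
    | trans _ _ ih₁ ih₂ => exact ih₁.trans ih₂
    | add _ _ ih₁ ih₂ => rw [eval_add, eval_add, ih₁, ih₂]
  · intro h
    refine hσ.induction hev h0 (P := fun x y => addConGen (fun x y => (x, y) ∈ σ) x y)
      (fun z => AddCon.refl _ z) (fun _ _ h₁ h₂ => AddCon.trans _ h₁ h₂)
      (fun g _ h => AddCon.add _ h (AddCon.refl _ g))
      (fun x y h => ?_) x y h
    have : addConGen (fun x y => (x, y) ∈ σ) x y := AddConGen.Rel.of x y h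
    exact ⟨this, AddCon.symm _ this⟩

lemma Exchanges.catenaryDegree_le [IsCancelAdd M] (hσ : Exchanges σ)
    (hev : ∀ x y, (x, y) ∈ σ → eval x = eval y) (h0 : ∀ z : Fact M, eval z = 0 → z = 0) {N : ℕ}
    (hN : ∀ x y, (x, y) ∈ σ → length x ≤ N ∧ length y ≤ N) : catenaryDegree M ≤ N := by
  refine iSup_le fun a => sInf_le ?_
  rintro z hz w rfl
  have hstep : ∀ {x y : Fact M}, eval x = eval y → length x ≤ N → length y ≤ N →
      Concatenated (eval x) N x y := fun {x y} h hx hy =>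
    Relation.ReflTransGen.single ⟨rfl, h.symm, by
      exact_mod_cast (dist_le x y).trans (max_le hx hy)⟩
  have := hσ.induction hev h0 (P := fun x y => Concatenated (eval x) N x y)
    (fun z => Relation.ReflTransGen.refl) (fun {x y z} h _ h₁ h₂ => ?_)
    (fun {x y} g _ h => ?_) (fun x y h => ?_) z w hz
  · have hz' : eval z = eval w := hz
    rwa [hz'] at this
  · rw [← h] at h₂
    exact Relation.ReflTransGen.trans h₁ h₂
  · refine Relation.ReflTransGen.lift (· + g) ?_ _ _ h
    rintro b c ⟨hb, hc, hd⟩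
    have hb' : eval b = eval x := hb
    have hc' : eval c = eval x := hc
    refine ⟨?_, ?_, ?_⟩
    · change eval (b + g) = eval (x + g)
      rw [eval_add, eval_add, hb']
    · change eval (c + g) = eval (x + g)
      rw [eval_add, eval_add, hc']
    · rwa [dist_add_right]
  · obtain ⟨hx, hy⟩ := hN x y h
    exact ⟨hstep (hev x y h) hx hy, hstep (hev x y h).symm hy hx⟩

/-- One exchange suffices, and its distance ignores the untouched part `g`. -/
lemma Exchanges.tameDegree_le (hσ : Exchanges σ)
    (hev : ∀ x y, (x, y) ∈ σ → eval x = eval y) {N : ℕ}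
    (hN : ∀ x y, (x, y) ∈ σ → length x ≤ N ∧ length y ≤ N) : tameDegree M ≤ N := by
  refine iSup_le fun u => iSup_le fun a => sInf_le ?_
  rintro ⟨w, hw, huw⟩ z rfl
  rcases Nat.eq_zero_or_pos (z u) with hzu | hzu
  · obtain ⟨x, y, g, rfl, hxy, hy, he⟩ := hσ.exists_eval_eq hev hw (pos_of_single_le huw) hzu
    refine ⟨y + g, he, single_le (by rw [Finsupp.add_apply]; omega), ?_⟩
    rw [dist_add_right]
    have : length x ≤ N ∧ length y ≤ N := by
      rcases hxy with h | h
      exacts [hN _ _ h, (hN _ _ h).symm]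
    exact_mod_cast (dist_le x y).trans (max_le this.1 this.2)
  · exact ⟨z, rfl, single_le hzu, by simp [dist_self]⟩

/-- A divisor `x` of a sum divides a subsum with at most `|x|` terms. -/
lemma exists_subsum {ι : Type*} [Fintype ι] (z : ι → Fact M) (x : Fact M) (hx : x ≤ ∑ i, z i) :
    ∃ Ω : Finset ι, Ω.card ≤ length x ∧ x ≤ ∑ i ∈ Ω, z i := by
  classical
  induction hn : length x generalizing x with
  | zero => exact ⟨∅, by simp, by simp [length_eq_zero.1 hn]⟩
  | succ n ih =>
    obtain ⟨u, hu⟩ := exists_pos (z := x) (by rintro rfl; simp at hn)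
    obtain ⟨y, rfl⟩ := exists_add_of_le (single_le hu)
    rw [length_add, length_single] at hn
    obtain ⟨Ω, hΩ, hy⟩ := ih y (le_add_self.trans hx) (by omega)
    by_cases hlt : y u + 1 ≤ (∑ i ∈ Ω, z i) u
    · refine ⟨Ω, by omega, fun v => ?_⟩
      by_cases hv : u = v
      · subst hv
        rw [Finsupp.add_apply, Finsupp.single_eq_same]; omega
      · rw [Finsupp.add_apply, Finsupp.single_eq_of_ne' hv, zero_add]; exact hy v
    -- The terms in `Ω` contain too few copies of `u` while the full sum contains enough, so some
    -- term outside `Ω` supplies one.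
    · obtain ⟨i, hi, hiu⟩ : ∃ i ∉ Ω, 0 < z i u := by
        by_contra! hcon
        have hsum : (∑ i, z i) u = (∑ i ∈ Ω, z i) u := by
          rw [Finsupp.finsetSum_apply, Finsupp.finsetSum_apply]
          exact (Finset.sum_subset (Finset.subset_univ _)
            fun i _ hi => Nat.le_zero.1 (hcon i hi)).symm
        have := hx u
        rw [hsum, Finsupp.add_apply, Finsupp.single_eq_same] at this
        omega
      refine ⟨insert i Ω, (Finset.card_insert_le _ _).trans (by omega), ?_⟩
      rw [Finset.sum_insert hi]
      exact add_le_add (single_le hiu) hy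

lemma Exchanges.omega_le (hσ : Exchanges σ)
    (hev : ∀ x y, (x, y) ∈ σ → eval x = eval y) (hM : Function.Surjective (eval (M := M)))
    {N : ℕ} (hN : ∀ x y, (x, y) ∈ σ → length x ≤ N ∧ length y ≤ N) (hN1 : 1 ≤ N) :
    omega M ≤ N := by
  refine iSup_le fun u => sInf_le ?_
  rintro n a - ⟨s, hs⟩
  obtain ⟨t, rfl⟩ := hM s
  choose z hz using fun i => hM (a i)
  -- Either `u` itself occurs in the sum, or the side of a relation consumed by an exchange has a
  -- value divisible by `u`. In both cases a short `x` suffices.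
  have hdvd : ∃ x : Fact M, x ≤ ∑ i, z i ∧ length x ≤ N ∧ Divides (u : M) (eval x) := by
    rcases Nat.eq_zero_or_pos ((∑ i, z i) u) with hu | hu
    · obtain ⟨x, y, g, hx, hxy, hy⟩ := hσ u (∑ i, z i) (Finsupp.single u 1 + t)
        (by rw [eval_sum, eval_add, eval_single, one_nsmul, ← hs]; simp [hz]) (by simp) hu
      refine ⟨x, by rw [hx]; exact le_self_add, ?_, ?_⟩
      · rcases hxy with h | h
        exacts [(hN _ _ h).1, (hN _ _ h).2]
      · have hxy' : eval x = eval y := by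
          rcases hxy with h | h
          exacts [hev _ _ h, (hev _ _ h).symm]
        obtain ⟨b, rfl⟩ := exists_add_of_le (single_le hy)
        exact ⟨eval b, by rw [hxy', eval_add]; simp⟩
    · exact ⟨Finsupp.single u 1, single_le hu, by simpa using hN1, 0, by simp⟩
  obtain ⟨x, hx, hlen, d, hd⟩ := hdvd
  obtain ⟨Ω, hcard, hΩ⟩ := exists_subsum z x hx
  obtain ⟨g, hg⟩ := exists_add_of_le hΩ
  refine ⟨Ω, by exact_mod_cast hcard.trans hlen, d + eval g, ?_⟩
  rw [← add_assoc, ← hd, ← eval_add, ← hg, eval_sum]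
  simp [hz]

/-- The congruence that relates factorizations with the same value, except that the first member of
an isolated pair is related to itself only. -/
def IsIsolatedPair.addCon {x y : Fact M} (h : IsIsolatedPair x y) : AddCon (Fact M) where
  r a b := eval a = eval b ∧ (a = x ↔ b = x)
  iseqv :=
    { refl := fun _ => ⟨rfl, Iff.rfl⟩
      symm := fun h => ⟨h.1.symm, h.2.symm⟩
      trans := fun h₁ h₂ => ⟨h₁.1.trans h₂.1, h₁.2.trans h₂.2⟩ }
  add' := by
    have key : ∀ a b g : Fact M, eval a = eval b → (a = x ↔ b = x) → a + g = x → b + g = x := by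
      intro a b g he hiff hx
      rcases h.eq_or (b + g) (by rw [← hx, eval_add, eval_add, he]) with hb | hb
      · exact hb
      · have hgx : g ≤ x := by rw [← hx]; exact le_add_self
        have hgy : g ≤ y := by rw [← hb]; exact le_add_self
        have hg := le_inf hgx hgy
        rw [h.inf_eq] at hg
        obtain rfl : g = 0 := le_antisymm hg (zero_le)
        rw [add_zero] at hx ⊢
        exact hiff.1 hx
    have key' : ∀ a b g : Fact M, eval a = eval b → (a = x ↔ b = x) →
        (a + g = x ↔ b + g = x) := fun a b g he hiff =>
      ⟨key a b g he hiff, key b a g he.symm hiff.symm⟩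
    rintro a b c d ⟨h₁, h₂⟩ ⟨h₃, h₄⟩
    refine ⟨by rw [eval_add, eval_add, h₁, h₃], (key' a b c h₁ h₂).trans ?_⟩
    rw [add_comm b c, add_comm b d]
    exact key' c d b h₃ h₄

/-- If `(x, y)` is omitted, the remaining relations lie in the congruence isolating `x`, which
separates `x` from `y`. Asymmetry rules out the reversed pair `(y, x)`. -/
lemma isMinimalPresentation_of_isIsolatedPair (hp : IsPresentation σ)
    (hiso : ∀ x y, (x, y) ∈ σ → IsIsolatedPair x y)
    (hasymm : ∀ x y, (x, y) ∈ σ → (y, x) ∉ σ) : IsMinimalPresentation σ := by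
  refine ⟨hp, fun τ hτ hpτ => ?_⟩
  obtain ⟨hsub, ⟨x, y⟩, hmem, hnot⟩ := Set.ssubset_iff_exists.1 hτ
  have h := hiso x y hmem
  have hle : addConGen (fun a b => (a, b) ∈ τ) ≤ h.addCon := by
    refine AddCon.addConGen_le.2 fun a b hab => ?_
    have hab' := hiso a b (hsub hab)
    refine ⟨hab'.eval_eq, ?_, ?_⟩
    · rintro rfl
      rcases h.eq_or b hab'.eval_eq.symm with rfl | rfl
      · rfl
      · exact absurd hab hnot
    · rintro rfl
      rcases h.eq_or a hab'.eval_eq with rfl | rfl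
      · rfl
      · exact absurd (hsub hab) (hasymm _ _ hmem)
  have := hle ((hpτ x y).2 h.eval_eq)
  exact h.ne (this.2.1 rfl).symm

end Upper

/-- The invariants of a reduced cancellative atomic monoid with a relation set of isolated pairs
that exchanges atoms. -/
lemma Exchanges.invariants_eq [IsCancelAdd M] {σ : Set (Fact M × Fact M)} (hσ : Exchanges σ)
    (hiso : ∀ x y, (x, y) ∈ σ → IsIsolatedPair x y) (h0 : ∀ z : Fact M, eval z = 0 → z = 0)
    (hM : Function.Surjective (eval (M := M))) {N : ℕ} (hN1 : 1 ≤ N)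
    (hN : ∀ B : ℕ∞, (N : ℕ∞) ≤ B ↔ ∀ x y, (x, y) ∈ σ → (length x : ℕ∞) ≤ B ∧ (length y : ℕ∞) ≤ B) :
    catenaryDegree M = N ∧ omega M = N ∧ tameDegree M = N := by
  have hev : ∀ x y, (x, y) ∈ σ → eval x = eval y := fun x y h => (hiso x y h).eval_eq
  have hN' : ∀ x y, (x, y) ∈ σ → length x ≤ N ∧ length y ≤ N := by
    intro x y h
    exact_mod_cast (hN N).1 le_rfl x y h
  -- By `hN`, the number `N` is the supremum of the lengths in `σ`, so each lower bound is checked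
  -- one relation at a time.
  refine ⟨le_antisymm (hσ.catenaryDegree_le hev h0 hN') ((hN _).2 fun x y h => ?_),
    le_antisymm (hσ.omega_le hev hM hN' hN1) ((hN _).2 fun x y h => ?_),
    le_antisymm (hσ.tameDegree_le hev hN') ((hN _).2 fun x y h => ?_)⟩
  · have := (hiso x y h).max_length_le_catenaryDegree
    rwa [Nat.mono_cast.map_max, max_le_iff] at this
  · exact ⟨(hiso x y h).length_le_omega hM, (hiso x y h).symm.length_le_omega hM⟩
  · have := (hiso x y h).max_length_le_tameDegree
    rwa [Nat.mono_cast.map_max, max_le_iff] at this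

end General

end Factorization

/-! ### Arithmetic of the three minimal relations -/

namespace Factorization

lemma sum_eq_of_ne {i j k : Fin 3} (hij : i ≠ j) (hik : i ≠ k) (hjk : j ≠ k) (f : Fin 3 → ℕ) :
    ∑ l, f l = f i + f j + f k := by
  have : (Finset.univ : Finset (Fin 3)) = {i, j, k} := by
    revert i j k; decide
  rw [this, Finset.sum_insert (by simp [hij, hik]), Finset.sum_insert (by simp [hjk]),
    Finset.sum_singleton, add_assoc]

lemma exists_others (i : Fin 3) : ∃ j k : Fin 3, i ≠ j ∧ i ≠ k ∧ j ≠ k := by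
  revert i; decide

lemma eq_of_ne {i j k : Fin 3} (hij : i ≠ j) (hik : i ≠ k) (hjk : j ≠ k) (l : Fin 3) :
    l = i ∨ l = j ∨ l = k := by
  revert i j k l; decide

/-- `c i` is the smallest positive integer with `c i * n i ∈ ⟨n j, n k⟩`, and `r i j`, `r i k` are
the coefficients of such a representation, all of them positive. -/
structure IsRelationSystem (n c : Fin 3 → ℕ) (r : Fin 3 → Fin 3 → ℕ) : Prop where
  pos : ∀ i, 0 < n i
  c_pos : ∀ i, 0 < c i
  r_pos : ∀ i j, i ≠ j → 0 < r i j
  le : ∀ {i j k}, i ≠ j → i ≠ k → j ≠ k → ∀ {m} p q, 0 < m → m * n i = p * n j + q * n k → c i ≤ m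
  eq : ∀ {i j k}, i ≠ j → i ≠ k → j ≠ k → c i * n i = r i j * n j + r i k * n k

namespace IsRelationSystem

variable {n c : Fin 3 → ℕ} {r : Fin 3 → Fin 3 → ℕ} (h : IsRelationSystem n c r)
include h

/-- If `p > r i j`, comparison with the given representation makes `p - r i j` copies of `n j` a
multiple of `n k`, so `c j ≤ p - r i j`. Replacing `c j` copies of `n j` introduces `n i`, and
cancelling it contradicts the minimality of `c i`. -/
lemma le_of_eq {i j k : Fin 3} (hij : i ≠ j) (hik : i ≠ k) (hjk : j ≠ k) {p q : ℕ}
    (he : p * n j + q * n k = c i * n i) : p ≤ r i j := by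
  by_contra! hlt
  obtain ⟨s, rfl⟩ := Nat.exists_eq_add_of_lt hlt
  have heq := h.eq hij hik hjk
  have hq : q ≤ r i k := by
    by_contra! hq
    obtain ⟨t, rfl⟩ := Nat.exists_eq_add_of_lt hq
    nlinarith [h.pos j, h.pos k, Nat.zero_le (s * n j), Nat.zero_le (t * n k)]
  obtain ⟨t, ht⟩ := Nat.exists_eq_add_of_le hq
  have hcj : c j ≤ s + 1 := by
    refine h.le hij.symm hjk hik 0 t s.succ_pos ?_
    rw [ht] at heq
    linarith
  obtain ⟨d, hd⟩ := Nat.exists_eq_add_of_le hcj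
  have hj := h.eq hij.symm hjk hik
  -- trade `c j` copies of `n j` for the other two
  have hkey : r j i * n i + (r i j + d) * n j + (r j k + q) * n k = c i * n i := by
    rw [← he, show r i j + s + 1 = r i j + d + c j by omega]
    linarith
  have hji := h.r_pos j i hij.symm
  have hjk' := h.r_pos j k hjk
  have hlt' : r j i < c i := by
    by_contra! hle
    have := Nat.mul_le_mul_right (n i) hle
    have : 0 < (r j k + q) * n k := Nat.mul_pos (by omega) (h.pos k)
    have := Nat.zero_le ((r i j + d) * n j)
    omega
  obtain ⟨e, he'⟩ := Nat.exists_eq_add_of_lt hlt'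
  have := h.le hij hik hjk (m := e + 1) (r i j + d) (r j k + q) e.succ_pos (by
    rw [he'] at hkey
    linarith)
  omega

lemma eq_or_eq {i j k : Fin 3} (hij : i ≠ j) (hik : i ≠ k) (hjk : j ≠ k) {x p q : ℕ}
    (he : x * n i + p * n j + q * n k = c i * n i) :
    (x = c i ∧ p = 0 ∧ q = 0) ∨ (x = 0 ∧ p = r i j ∧ q = r i k) := by
  have hi := h.pos i
  have hj := h.pos j
  have hk := h.pos k
  have hxc : x ≤ c i := by
    refine Nat.le_of_mul_le_mul_right ?_ hi
    omega
  obtain ⟨m, hm⟩ := Nat.exists_eq_add_of_le hxc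
  rcases Nat.eq_zero_or_pos m with rfl | hm0
  · left
    have hx : x = c i := by omega
    rw [hx] at he
    have h1 : p * n j = 0 := by omega
    have h2 : q * n k = 0 := by omega
    rw [Nat.mul_eq_zero] at h1 h2
    omega
  · right
    have := h.le hij hik hjk p q hm0 (by rw [hm] at he; linarith)
    obtain rfl : x = 0 := by omega
    rw [zero_mul, zero_add] at he
    -- Both coefficients are bounded by those of the relation and the weighted sums agree, so
    -- equality holds in each.
    have hp := h.le_of_eq hij hik hjk he
    have hq := h.le_of_eq hik hij hjk.symm (p := q) (q := p) (by rw [← he, add_comm])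
    have heq := h.eq hij hik hjk
    have h1 := Nat.mul_le_mul_right (n j) hp
    have h2 := Nat.mul_le_mul_right (n k) hq
    exact ⟨rfl, Nat.eq_of_mul_eq_mul_right hj (by omega), Nat.eq_of_mul_eq_mul_right hk (by omega)⟩

lemma not_lt_of_eq {j i k : Fin 3} (hij : i ≠ j) (hik : i ≠ k) (hjk : j ≠ k) {x y p t : ℕ}
    (hlt : y < p) (hp : p < c j) (he : p * n j = x * n i + y * n j + t * n k) : False := by
  obtain ⟨s, rfl⟩ := Nat.exists_eq_add_of_lt hlt
  have := h.le hij.symm hjk hik (m := s + 1) x t s.succ_pos (by linarith)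
  omega

/-- The right-hand side is a factorization without atom `i`; the alternatives say that relation `j`
or `k` applies to it forwards, or relation `i` backwards. If the first two fail, minimality of `c j`
and `c k` allows cancelling down to `x * n i = p' * n j + q' * n k`, and the same minimality forces
`p'` and `q'` to dominate `r i j` and `r i k`. -/
lemma exchange {i j k : Fin 3} (hij : i ≠ j) (hik : i ≠ k) (hjk : j ≠ k) {x y t p q : ℕ}
    (hx : 0 < x) (he : x * n i + y * n j + t * n k = p * n j + q * n k) :
    c j ≤ p ∨ c k ≤ q ∨ (r i j ≤ p ∧ r i k ≤ q) := by
  by_contra! hcon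
  obtain ⟨hp, hq, hr⟩ := hcon
  have hi := Nat.mul_pos hx (h.pos i)
  have hyp : y ≤ p := by
    by_contra! hlt
    have h1 := Nat.mul_le_mul_right (n j) hlt.le
    have htq : t < q := by
      by_contra! hle
      have := Nat.mul_le_mul_right (n k) hle
      omega
    obtain ⟨d, rfl⟩ := Nat.exists_eq_add_of_lt hlt
    exact h.not_lt_of_eq hik hij hjk.symm (x := x) (t := d + 1) htq hq (by linarith)
  have htq : t ≤ q := by
    by_contra! hlt
    have h1 := Nat.mul_le_mul_right (n k) hlt.le
    have hyp : y < p := by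
      by_contra! hle
      have := Nat.mul_le_mul_right (n j) hle
      omega
    obtain ⟨d, rfl⟩ := Nat.exists_eq_add_of_lt hlt
    exact h.not_lt_of_eq hij hik hjk (x := x) (t := d + 1) hyp hp (by linarith)
  obtain ⟨p', rfl⟩ := Nat.exists_eq_add_of_le hyp
  obtain ⟨q', rfl⟩ := Nat.exists_eq_add_of_le htq
  have he' : x * n i = p' * n j + q' * n k := by linarith
  have hcx := h.le hij hik hjk p' q' hx he'
  obtain ⟨d, rfl⟩ := Nat.exists_eq_add_of_le hcx
  have heq := h.eq hij hik hjk
  have hcase : r i j ≤ p' ∧ r i k ≤ q' := by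
    by_contra hnot
    rcases Nat.lt_or_ge (r i j) p' with h1 | h1
    · have h2 : q' < r i k := by omega
      obtain ⟨e, he2⟩ := Nat.exists_eq_add_of_lt h2
      refine h.not_lt_of_eq hij hik hjk (x := d) (t := e + 1) h1 (by omega) ?_
      rw [he2] at heq
      linarith
    · rcases Nat.lt_or_ge (r i k) q' with h2 | h2
      · have h3 : p' < r i j := by omega
        obtain ⟨e, he2⟩ := Nat.exists_eq_add_of_lt h3
        refine h.not_lt_of_eq hik hij hjk.symm (x := d) (t := e + 1) h2 (by omega) ?_
        rw [he2] at heq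
        linarith
      · have h3 := Nat.mul_le_mul_right (n j) h1
        have h4 := Nat.mul_le_mul_right (n k) h2
        have h5 : c i * n i ≤ (c i + d) * n i := Nat.mul_le_mul_right _ (Nat.le_add_right _ _)
        have h6 : p' = r i j := Nat.eq_of_mul_eq_mul_right (h.pos j) (by omega)
        have h7 : q' = r i k := Nat.eq_of_mul_eq_mul_right (h.pos k) (by omega)
        omega
  have := hr (by omega)
  omega

end IsRelationSystem

/-- In a representation of a multiple of `a` by `b` and `d`, where `a`, `b`, `d` are pairwise
coprime and none of them lies in the monoid generated by the others, the coefficient of `b` is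
positive as soon as the multiple is the smallest one. -/
lemma coeff_pos {a b d m p q : ℕ} (hab : ∀ x y, b ≠ x * a + y * d) (had : Nat.Coprime a d)
    (hbd : Nat.Coprime b d) (hd : 0 < d) (hm : 0 < m)
    (hmin : ∀ m' p' q', 0 < m' → m' * a = p' * b + q' * d → m ≤ m') (he : m * a = p * b + q * d) :
    0 < p := by
  refine Nat.pos_of_ne_zero fun hp => ?_
  subst hp
  rw [zero_mul, zero_add] at he
  have hdm : d ∣ m := had.symm.dvd_of_dvd_mul_right ⟨q, by rw [he, mul_comm]⟩
  have hd1 : d ≠ 1 := by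
    rintro rfl
    exact hab 0 b (by simp)
  -- The residue `m₀ < d ≤ m` solves `m₀ * a ≡ b` modulo `d`. If `m₀ * a ≥ b`, it contradicts the
  -- minimality of `m`; otherwise `b` lies in the monoid generated by `a` and `d`.
  obtain ⟨m₀, hm₀⟩ := Nat.exists_mul_mod_eq_of_coprime b had hd.ne'
  obtain ⟨hlt, hmod⟩ := hm₀
  have hmod' : m₀ * a ≡ b [MOD d] := by
    rw [mul_comm]; exact hmod
  rcases Nat.eq_zero_or_pos m₀ with h0 | h0
  · subst h0
    rw [zero_mul] at hmod'
    have : d ∣ b := (Nat.modEq_zero_iff_dvd).1 hmod'.symm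
    exact hd1 (Nat.eq_one_of_dvd_coprimes hbd this dvd_rfl)
  · rcases le_total b (m₀ * a) with hle | hle
    · obtain ⟨s, hs⟩ := (Nat.modEq_iff_dvd' hle).1 hmod'.symm
      have h1 := hmin m₀ 1 s h0 (by rw [one_mul, mul_comm s]; omega)
      have := Nat.le_of_dvd hm hdm
      omega
    · obtain ⟨s, hs⟩ := (Nat.modEq_iff_dvd' hle).1 hmod'
      exact hab m₀ s (by rw [mul_comm s]; omega)

/-! ### Factorizations in a submonoid with three atoms -/

section Submonoid

variable {S : AddSubmonoid ℕ}

lemma isAddUnit_iff_eq_zero (a : S) : IsAddUnit a ↔ a = 0 := by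
  constructor
  · intro ha
    obtain ⟨b, hb⟩ := ha.exists_neg
    have : (a : ℕ) + b = 0 := congrArg Subtype.val hb
    exact Subtype.ext (Nat.eq_zero_of_add_eq_zero_right this)
  · rintro rfl
    exact isAddUnit_zero

lemma atoms_pos (u : atoms S) : 0 < ((u : S) : ℕ) := by
  refine Nat.pos_of_ne_zero fun h => u.2.not_isAddUnit ?_
  rw [isAddUnit_iff_eq_zero]
  exact Subtype.ext h

lemma eq_zero_of_eval_eq_zero (z : Fact S) (hz : eval z = 0) : z = 0 := by
  by_contra hne
  obtain ⟨u, hu⟩ := exists_pos hne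
  obtain ⟨g, rfl⟩ := exists_add_of_le (single_le hu)
  rw [eval_add, eval_single, one_nsmul] at hz
  have : ((u : S) : ℕ) + (eval g : S) = 0 := congrArg Subtype.val hz
  have := atoms_pos u
  omega

lemma eval_surjective : Function.Surjective (eval (M := S)) := by
  intro a
  induction hn : (a : ℕ) using Nat.strong_induction_on generalizing a with
  | _ n ih =>
    subst hn
    by_cases ha : AddIrreducible a
    · exact ⟨Finsupp.single ⟨a, ha⟩ 1, by simp⟩
    · by_cases h0 : a = 0
      · exact ⟨0, by simp [h0]⟩
      · rw [addIrreducible_iff] at ha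
        push Not at ha
        obtain ⟨b, d, rfl, hb, hd⟩ := ha (by rwa [isAddUnit_iff_eq_zero])
        rw [isAddUnit_iff_eq_zero] at hb hd
        have hb' : (b : ℕ) ≠ 0 := fun h => hb (Subtype.ext h)
        have hd' : (d : ℕ) ≠ 0 := fun h => hd (Subtype.ext h)
        have hsum : ((b + d : S) : ℕ) = b + d := rfl
        obtain ⟨z, hz⟩ := ih b (by omega) b rfl
        obtain ⟨w, hw⟩ := ih d (by omega) d rfl
        exact ⟨z + w, by rw [eval_add, hz, hw]⟩

/-- An atom is not a sum of multiples of two other atoms. -/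
lemma atom_ne (u v w : atoms S) (huv : u ≠ v) (huw : u ≠ w) (x y : ℕ) :
    ((u : S) : ℕ) ≠ x * ((v : S) : ℕ) + y * ((w : S) : ℕ) := by
  intro h
  have hS : (u : S) = x • (v : S) + y • (w : S) := Subtype.ext (by simpa using h)
  have key : ∀ (v : atoms S) (s : S), u ≠ v → (u : S) ≠ (v : S) + s := by
    intro v s huv hs
    rcases u.2.isAddUnit_or_isAddUnit hs with h1 | h1
    · exact v.2.not_isAddUnit h1
    · rw [isAddUnit_iff_eq_zero] at h1
      rw [h1, add_zero] at hs
      exact huv (Subtype.ext hs)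
  rcases x with _ | x
  · rcases y with _ | y
    · have := atoms_pos u
      omega
    · exact key w (y • (w : S)) huw (by rw [hS, zero_nsmul, zero_add, succ_nsmul'])
  · exact key v (x • (v : S) + y • (w : S)) huv (by rw [hS, succ_nsmul', add_assoc])

/-- The factorization with prescribed multiplicities of the three atoms. -/
noncomputable def ofFun (e : Fin 3 ≃ atoms S) (f : Fin 3 → ℕ) : Fact S :=
  ∑ i, Finsupp.single (e i) (f i)

variable (e : Fin 3 ≃ atoms S)

lemma ofFun_apply (f : Fin 3 → ℕ) (i : Fin 3) : ofFun e f (e i) = f i := by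
  rw [ofFun, Finsupp.finsetSum_apply, Finset.sum_eq_single i]
  · simp
  · intro j _ hj
    exact Finsupp.single_eq_of_ne' fun h => hj (e.injective h)
  · simp

lemma ofFun_coords (z : Fact S) : ofFun e (fun i => z (e i)) = z := by
  ext u
  obtain ⟨i, rfl⟩ := e.surjective u
  rw [ofFun_apply]

lemma ext_coords {z w : Fact S} (h : ∀ i, z (e i) = w (e i)) : z = w := by
  rw [← ofFun_coords e z, ← ofFun_coords e w]
  simp only [h]

lemma eval_eq_sum (z : Fact S) : ((eval z : S) : ℕ) = ∑ i, z (e i) * ((e i : S) : ℕ) := by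
  conv_lhs => rw [← ofFun_coords e z, ofFun, eval_sum]
  simp

lemma length_ofFun (f : Fin 3 → ℕ) : length (ofFun e f) = ∑ i, f i := by
  simp [ofFun, length]

/-- The left-hand side `c i • n i` of the `i`-th relation. -/
noncomputable def powerSide (c : Fin 3 → ℕ) (i : Fin 3) : Fact S :=
  ofFun e (Pi.single i (c i))

/-- The right-hand side `r i j • n j + r i k • n k` of the `i`-th relation. -/
noncomputable def mixedSide (r : Fin 3 → Fin 3 → ℕ) (i : Fin 3) : Fact S :=
  ofFun e (fun j => if j = i then 0 else r i j)

lemma powerSide_self (c : Fin 3 → ℕ) (i : Fin 3) : powerSide e c i (e i) = c i := by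
  rw [powerSide, ofFun_apply, Pi.single_eq_same]

lemma powerSide_of_ne (c : Fin 3 → ℕ) {i j : Fin 3} (h : i ≠ j) : powerSide e c i (e j) = 0 := by
  rw [powerSide, ofFun_apply, Pi.single_eq_of_ne' h]

lemma mixedSide_self (r : Fin 3 → Fin 3 → ℕ) (i : Fin 3) : mixedSide e r i (e i) = 0 := by
  rw [mixedSide, ofFun_apply, if_pos rfl]

lemma mixedSide_of_ne (r : Fin 3 → Fin 3 → ℕ) {i j : Fin 3} (h : i ≠ j) :
    mixedSide e r i (e j) = r i j := by
  rw [mixedSide, ofFun_apply, if_neg h.symm]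

lemma eval_powerSide (c : Fin 3 → ℕ) (i : Fin 3) :
    ((eval (powerSide e c i) : S) : ℕ) = c i * ((e i : S) : ℕ) := by
  rw [eval_eq_sum e, Finset.sum_eq_single i]
  · rw [powerSide_self]
  · intro j _ hj
    rw [powerSide_of_ne e c hj.symm, zero_mul]
  · simp

/-- The three relations between the atoms. -/
def relations (c : Fin 3 → ℕ) (r : Fin 3 → Fin 3 → ℕ) : Set (Fact S × Fact S) :=
  Set.range fun i => (powerSide e c i, mixedSide e r i)

variable {e} {c : Fin 3 → ℕ} {r : Fin 3 → Fin 3 → ℕ}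

lemma mem_relations (i : Fin 3) : (powerSide e c i, mixedSide e r i) ∈ relations e c r := ⟨i, rfl⟩

lemma forall_relations {P : Fact S → Fact S → Prop} :
    (∀ x y, (x, y) ∈ relations e c r → P x y) ↔ ∀ i, P (powerSide e c i) (mixedSide e r i) := by
  constructor
  · exact fun h i => h _ _ ⟨i, rfl⟩
  · rintro h x y ⟨i, hi⟩
    obtain ⟨rfl, rfl⟩ := Prod.mk.inj hi
    exact h i

section System

variable (h : IsRelationSystem (fun i => ((e i : S) : ℕ)) c r)
include h

lemma IsRelationSystem.isIsolatedPair (i : Fin 3) :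
    IsIsolatedPair (powerSide e c i) (mixedSide e r i) := by
  obtain ⟨j, k, hij, hik, hjk⟩ := exists_others i
  refine ⟨?_, ?_, ?_, ?_, ?_⟩
  · refine Subtype.ext ?_
    rw [eval_powerSide, h.eq hij hik hjk, eval_eq_sum e, sum_eq_of_ne hij hik hjk,
      mixedSide_self, mixedSide_of_ne e r hij, mixedSide_of_ne e r hik]
    ring
  · refine ext_coords e fun l => ?_
    rw [Finsupp.inf_apply]
    by_cases hl : i = l
    · subst hl; simp [mixedSide_self]
    · simp [powerSide_of_ne e c hl]
  · intro h0
    have := powerSide_self e c i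
    rw [h0] at this
    exact (h.c_pos i).ne this
  · intro h0
    have := mixedSide_of_ne e r hij
    rw [h0] at this
    exact (h.r_pos i j hij).ne this
  · intro z hz
    have hz' := congrArg Subtype.val hz
    rw [eval_powerSide, eval_eq_sum e, sum_eq_of_ne hij hik hjk] at hz'
    rcases h.eq_or_eq hij hik hjk hz' with ⟨h1, h2, h3⟩ | ⟨h1, h2, h3⟩
    · left
      refine ext_coords e fun l => ?_
      rcases eq_of_ne hij hik hjk l with rfl | rfl | rfl
      · rw [h1, powerSide_self]
      · rw [h2, powerSide_of_ne e c hij]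
      · rw [h3, powerSide_of_ne e c hik]
    · right
      refine ext_coords e fun l => ?_
      rcases eq_of_ne hij hik hjk l with rfl | rfl | rfl
      · rw [h1, mixedSide_self]
      · rw [h2, mixedSide_of_ne e r hij]
      · rw [h3, mixedSide_of_ne e r hik]

lemma IsRelationSystem.exchanges : Exchanges (relations e c r) := by
  intro u z w hzw hw hz
  obtain ⟨i, rfl⟩ := e.surjective u
  obtain ⟨j, k, hij, hik, hjk⟩ := exists_others i
  have heq := congrArg Subtype.val hzw
  rw [eval_eq_sum e, eval_eq_sum e, sum_eq_of_ne hij hik hjk, sum_eq_of_ne hij hik hjk, hz,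
    zero_mul, zero_add] at heq
  -- Relation `l ≠ i`, used forwards, produces atom `i` because `r l i > 0`.
  have power : ∀ l, l ≠ i → c l ≤ z (e l) → ∃ x y g, z = x + g ∧
      ((x, y) ∈ relations e c r ∨ (y, x) ∈ relations e c r) ∧ 0 < y (e i) := by
    intro l hl hle
    obtain ⟨g, hg⟩ := exists_add_of_le (a := powerSide e c l) (b := z) (fun v => by
      obtain ⟨l', rfl⟩ := e.surjective v
      by_cases hl' : l = l'
      · subst hl'; rwa [powerSide_self]
      · rw [powerSide_of_ne e c hl']; exact zero_le)
    refine ⟨_, _, g, hg, Or.inl (mem_relations l), ?_⟩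
    rw [mixedSide_of_ne e r hl]
    exact h.r_pos l i hl
  rcases h.exchange hij hik hjk hw heq with hj | hk | ⟨hj, hk⟩
  · exact power j hij.symm hj
  · exact power k hik.symm hk
  · obtain ⟨g, hg⟩ := exists_add_of_le (a := mixedSide e r i) (b := z) (fun v => by
      obtain ⟨l, rfl⟩ := e.surjective v
      rcases eq_of_ne hij hik hjk l with rfl | rfl | rfl
      · rw [mixedSide_self]; exact zero_le
      · rwa [mixedSide_of_ne e r hij]
      · rwa [mixedSide_of_ne e r hik])
    refine ⟨_, _, g, hg, Or.inr (mem_relations i), ?_⟩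
    rw [powerSide_self]
    exact h.c_pos i

lemma IsRelationSystem.isGenericPresentation : IsGenericPresentation (relations e c r) := by
  refine ⟨isMinimalPresentation_of_isIsolatedPair (h.exchanges.isPresentation
    (forall_relations.2 fun i => (h.isIsolatedPair i).eval_eq) eq_zero_of_eval_eq_zero)
    (forall_relations.2 h.isIsolatedPair) (forall_relations.2 fun i => ?_),
    forall_relations.2 fun i u => ?_⟩
  -- A power side involves one atom and a mixed side two, so no relation is the reverse of another.
  · rintro ⟨l, hl⟩
    have hl' : powerSide e c l = mixedSide e r i := (Prod.mk.inj hl).1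
    obtain ⟨j, k, hij, hik, hjk⟩ := exists_others i
    have hj := DFunLike.congr_fun hl' (e j)
    have hk := DFunLike.congr_fun hl' (e k)
    rw [mixedSide_of_ne e r hij] at hj
    rw [mixedSide_of_ne e r hik] at hk
    have hrj := h.r_pos i j hij
    have hrk := h.r_pos i k hik
    by_cases hlj : l = j
    · subst hlj
      rw [powerSide_of_ne e c hjk] at hk
      omega
    · rw [powerSide_of_ne e c hlj] at hj
      omega
  · obtain ⟨l, rfl⟩ := e.surjective u
    rw [Finsupp.mem_support_iff, Finsupp.add_apply]
    by_cases hl : i = l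
    · subst hl
      rw [powerSide_self]
      have := h.c_pos i
      omega
    · rw [mixedSide_of_ne e r hl]
      have := h.r_pos i l hl
      omega

lemma IsRelationSystem.invariants_eq {N : ℕ}
    (hN : N = ({c 0, c 1, c 2, r 0 1 + r 0 2, r 1 0 + r 1 2, r 2 0 + r 2 1} : Finset ℕ).sup id) :
    catenaryDegree S = N ∧ omega S = N ∧ tameDegree S = N := by
  refine h.exchanges.invariants_eq (forall_relations.2 h.isIsolatedPair) eq_zero_of_eval_eq_zero
    eval_surjective ((h.c_pos 0).trans_le ?_) fun B => ?_
  · rw [hN]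
    exact Finset.le_sup (f := id) (by simp)
  · rw [forall_relations (P := fun x y => (length x : ℕ∞) ≤ B ∧ (length y : ℕ∞) ≤ B), hN]
    cases B with
    | top => simp
    | coe b =>
      simp only [powerSide, mixedSide, length_ofFun, Nat.cast_le, Finset.sup_le_iff, id_eq,
        Finset.mem_insert, Finset.mem_singleton, forall_eq_or_imp, forall_eq, Fin.forall_fin_succ,
        Fin.sum_univ_three, Finset.sum_pi_single']
      simp
      tauto

end System

end Submonoid

/-- The hypotheses on `c` and `r`: `c i` is the smallest positive integer with
`c i * n i ∈ ⟨n j, n k⟩`, and `r i j`, `r i k` are coefficients of a representation. -/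
def HasMinimalMultiples (n c : Fin 3 → ℕ) (r : Fin 3 → Fin 3 → ℕ) : Prop :=
  ∀ i j k : Fin 3, i ≠ j → i ≠ k → j ≠ k →
    IsLeast {m : ℕ | 0 < m ∧ m * n i ∈ AddSubmonoid.closure {n j, n k}} (c i) ∧
    c i * n i = r i j * n j + r i k * n k

/-- Needed because the generic presentation and the equality of the invariants are claimed without
reference to any `c` and `r`. -/
lemma exists_hasMinimalMultiples {n : Fin 3 → ℕ} (hn : ∀ i, 0 < n i) :
    ∃ c r, HasMinimalMultiples n c r := by
  have key : ∀ i : Fin 3, ∃ m p q,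
      IsLeast {m : ℕ | 0 < m ∧ m * n i ∈ AddSubmonoid.closure {n (i + 1), n (i + 2)}} m ∧
      m * n i = p * n (i + 1) + q * n (i + 2) := by
    intro i
    have hne : {m : ℕ | 0 < m ∧
        m * n i ∈ AddSubmonoid.closure {n (i + 1), n (i + 2)}}.Nonempty :=
      ⟨n (i + 1), hn _, (AddSubmonoid.mem_closure_pair _ _ _).2 ⟨n i, 0, by simp [mul_comm]⟩⟩
    have hmem := Nat.sInf_mem hne
    obtain ⟨p, q, hpq⟩ := (AddSubmonoid.mem_closure_pair _ _ _).1 hmem.2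
    exact ⟨_, p, q, ⟨hmem, fun _ hm => Nat.sInf_le hm⟩, by simpa using hpq.symm⟩
  choose c p q hc he using key
  -- The other two indices are `i + 1` and `i + 2` modulo 3; the value of `r i i` is irrelevant.
  refine ⟨c, fun i j => if j = i + 1 then p i else q i, fun i j k hij hik hjk => ?_⟩
  have hcases : (j = i + 1 ∧ k = i + 2) ∨ (j = i + 2 ∧ k = i + 1) := by
    revert i j k; decide
  have h12 : i + 2 ≠ i + 1 := by simp
  rcases hcases with ⟨rfl, rfl⟩ | ⟨rfl, rfl⟩
  · exact ⟨hc i, by simpa [h12] using he i⟩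
  · refine ⟨by rw [Set.pair_comm]; exact hc i, ?_⟩
    simpa [h12, add_comm] using he i

lemma HasMinimalMultiples.isRelationSystem {n c : Fin 3 → ℕ} {r : Fin 3 → Fin 3 → ℕ}
    (h : HasMinimalMultiples n c r) (hpos : ∀ i, 0 < n i)
    (hne : ∀ i j k, i ≠ j → i ≠ k → ∀ x y, n i ≠ x * n j + y * n k)
    (hcop : ∀ i j : Fin 3, i ≠ j → Nat.Coprime (n i) (n j)) : IsRelationSystem n c r := by
  have hcpos : ∀ i, 0 < c i := fun i => by
    obtain ⟨j, k, hij, hik, hjk⟩ := exists_others i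
    exact (h i j k hij hik hjk).1.1.1
  have hle : ∀ {i j k}, i ≠ j → i ≠ k → j ≠ k → ∀ {m} p q, 0 < m →
      m * n i = p * n j + q * n k → c i ≤ m := fun hij hik hjk _ p q hm he =>
    (h _ _ _ hij hik hjk).1.2 ⟨hm, (AddSubmonoid.mem_closure_pair _ _ _).2 ⟨p, q, by simpa using he.symm⟩⟩
  refine ⟨hpos, hcpos, fun i j hij => ?_, hle, fun hij hik hjk => (h _ _ _ hij hik hjk).2⟩
  obtain ⟨k, hik, hjk⟩ : ∃ k, i ≠ k ∧ j ≠ k := by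
    revert i j; decide
  exact coeff_pos (hne j i k hij.symm hjk) (hcop i k hik) (hcop j k hjk) (hpos k) (hcpos i)
    (fun _ p q => hle hij hik hjk p q) (h i j k hij hik hjk).2

end Factorization

theorem corollary5p7 (S : AddSubmonoid ℕ) (hS : Factorization.IsNumericalMonoid S)
    (n : Fin 3 → ℕ) (hn : Function.Injective n)
    (hatoms : (fun a : S => (a : ℕ)) '' Factorization.atoms S = {n 0, n 1, n 2})
    (hcop : ∀ i j : Fin 3, i ≠ j → Nat.Coprime (n i) (n j)) :
    (∃ σ : Set (Factorization.Fact S × Factorization.Fact S),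
      Factorization.IsGenericPresentation σ) ∧
    Factorization.catenaryDegree S = Factorization.omega S ∧
    Factorization.omega S = Factorization.tameDegree S ∧
    ∀ (c : Fin 3 → ℕ) (r : Fin 3 → Fin 3 → ℕ),
      (∀ i j k : Fin 3, i ≠ j → i ≠ k → j ≠ k →
        IsLeast {m : ℕ | 0 < m ∧ m * n i ∈ AddSubmonoid.closure {n j, n k}} (c i) ∧
        c i * n i = r i j * n j + r i k * n k) →
      Factorization.catenaryDegree S =
        (({c 0, c 1, c 2, r 0 1 + r 0 2, r 1 0 + r 1 2, r 2 0 + r 2 1} : Finset ℕ).sup id : ℕ) := by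
  have hmem : ∀ i, ∃ u : Factorization.atoms S, ((u : S) : ℕ) = n i := by
    intro i
    have : n i ∈ (fun a : S => (a : ℕ)) '' Factorization.atoms S := by
      rw [hatoms]; fin_cases i <;> simp
    obtain ⟨a, ha, hai⟩ := this
    exact ⟨⟨a, ha⟩, hai⟩
  choose f hf using hmem
  have hbij : Function.Bijective f := by
    refine ⟨fun i j hij => hn (by rw [← hf, ← hf, hij]), fun u => ?_⟩
    have hu : ((u : S) : ℕ) ∈ ({n 0, n 1, n 2} : Set ℕ) := by
      rw [← hatoms]; exact ⟨u, u.2, rfl⟩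
    have : ∃ i, n i = ((u : S) : ℕ) := by
      rcases hu with h | h | h
      exacts [⟨0, h.symm⟩, ⟨1, h.symm⟩, ⟨2, h.symm⟩]
    obtain ⟨i, hi⟩ := this
    exact ⟨i, Subtype.ext (Subtype.ext ((hf i).trans hi))⟩
  let e : Fin 3 ≃ Factorization.atoms S := Equiv.ofBijective f hbij
  have he : (fun i => ((e i : S) : ℕ)) = n := funext hf
  have hpos : ∀ i, 0 < n i := fun i => by rw [← hf]; exact Factorization.atoms_pos _
  have hsys : ∀ c r, Factorization.HasMinimalMultiples n c r →
      Factorization.IsRelationSystem (fun i => ((e i : S) : ℕ)) c r := by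
    intro c r h
    rw [he]
    refine h.isRelationSystem hpos (fun i j k hij hik x y => ?_) hcop
    rw [← hf, ← hf, ← hf]
    exact Factorization.atom_ne _ _ _ (hbij.1.ne hij) (hbij.1.ne hik) x y
  -- One choice of coefficients yields the presentation and the equalities; the formula is then
  -- proved afresh for each admissible choice.
  obtain ⟨c, r, hcr⟩ := Factorization.exists_hasMinimalMultiples hpos
  obtain ⟨h₁, h₂, h₃⟩ := (hsys c r hcr).invariants_eq rfl
  exact ⟨⟨_, (hsys c r hcr).isGenericPresentation⟩, h₁.trans h₂.symm, h₂.trans h₃.symm,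
    fun c' r' h' => ((hsys c' r' h').invariants_eq rfl).1⟩
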